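/- Let $p$ be a prime, let $n$ be a natural number, and let $G=\mathbb Z^n\ltimes \mathrm{UT}_n(\mathbb Z[1/p])$ be the semidirect product with multiplication $(x,f)(y,g)=(x+y,\ f\,\zeta_x(g))$, where $\zeta_x(g)=XgX^{-1}$ and $X=\operatorname{diag}(p^{x_1},\dots,p^{x_n})$. Let $|\cdot|$ be the word length on $G$ with respect to the generators $(e_i, I)$ for $1\le i\le n$ and $(0,I+E_{rs})$ for $1\le r<s\le n$ (here $e_i$ are the unit vectors and $E_{rs}$ the matrix units) and their inverses. Let $\mu$ be a probability measure on the discrete group $G$ with finite first moment with respect to $|\cdot|$ and such that the group generated by the support of $\mu$ is non-abelian. Put $d_i=\int_G x_i\,d\mu(x,f)$ and $D_{ij}=d_i-d_j$. Suppose that $D$ is non-zero, i.e. $D_{ij}\neq0$ for all $i<j$, and column consistent, i.e. for each $j$ all the entries $D_{ij}$ with $i<j$ have the same sign. Let $(x^{(1)},f^{(1)}),(x^{(2)},f^{(2)}),\dots$ be independent random elements of $G$ with law $\mu$ and let $(y^{(m)},\varphi^{(m)})=(x^{(1)},f^{(1)})\cdots(x^{(m)},f^{(m)})$ be the associated right random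 walk. Let $\Gamma$ be the space of upper unitriangular $n\times n$ arrays $b$ whose entries $b_{ij}$, $i<j$, lie in $\mathbb R$ if $D_{ij}<0$ and in $\mathbb Q_p$ if $D_{ij}>0$. For $m\in\mathbb N$ let $t^{(m)}=(\lfloor m d_1\rfloor,\dots,\lfloor m d_n\rfloor)$ and $M_{ij}=t^{(m)}_i-t^{(m)}_j$. For $b\in\Gamma$ let $T^{(m)}(b)\in \mathrm{UT}_n(\mathbb Z[1/p])$ be the unitriangular matrix with entries, for $i<j$, $$T^{(m)}(b)_{ij}=\begin{cases}p^{M_{ij}}\lfloor p^{-M_{ij}}b_{ij}\rfloor & \text{if } D_{ij}<0,\\ p^{M_{ij}}\{p^{-M_{ij}}b_{ij}\} & \text{if } D_{ij}>0,\end{cases}$$ where $\{z\}$, for $z\in\mathbb Q_p$, is the $p$-adic fractional part, i.e. the unique element of $\mathbb Z[1/p]\cap[0,1)$ with $z-\{z\}\in\mathbb Z_p$. Let $\Pi^{(m)}:\Gamma\to G$ be given by $\Pi^{(m)}(b)=(t^{(m)},T^{(m)}(b))$. Then each $\Pi^{(m)}$ is measurable and, almost surely, $\varphi^{(m)}$ converges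 entrywise to a point $\varphi^{(\infty)}$ of $\Gamma$ (in $\mathbb R$ or $\mathbb Q_p$ according to the entry) and $$\left|\Pi^{(m)}(\varphi^{(\infty)})^{-1}\,(y^{(m)},\varphi^{(m)})\right| = O(m)\qquad (m\to\infty).$$ -/

import Mathlib

open MeasureTheory ProbabilityTheory Filter Topology
open scoped ENNReal

noncomputable section

namespace SolvWalk

/-! ### The ring of `p`-adic rationals and the group `ℤⁿ ⋉ UTₙ(ℤ[1/p])` -/

/-- The subring `ℤ[1/p] = {a / p ^ k : a ∈ ℤ, k ∈ ℕ}` of `ℚ`. -/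
def Zinv (p : ℕ) [Fact p.Prime] : Subring ℚ where
  carrier := {q | ∃ (a : ℤ) (k : ℕ), q = a / (p : ℚ) ^ k}
  one_mem' := ⟨1, 0, by simp⟩
  zero_mem' := ⟨0, 0, by simp⟩
  neg_mem' := by
    rintro _ ⟨a, k, rfl⟩
    exact ⟨-a, k, by push_cast; ring⟩
  mul_mem' := by
    rintro _ _ ⟨a, k, rfl⟩ ⟨b, l, rfl⟩
    exact ⟨a * b, k + l, by push_cast; rw [pow_add, div_mul_div_comm]⟩
  add_mem' := by
    rintro _ _ ⟨a, k, rfl⟩ ⟨b, l, rfl⟩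
    have hp : (p : ℚ) ≠ 0 := by exact_mod_cast (Fact.out : p.Prime).ne_zero
    exact ⟨a * p ^ l + b * p ^ k, k + l, by push_cast; field_simp; ring⟩

variable {p : ℕ} [Fact p.Prime] {n : ℕ}

theorem zpow_mem_Zinv (k : ℤ) : (p : ℚ) ^ k ∈ Zinv p := by
  rcases Int.eq_nat_or_neg k with ⟨m, rfl | rfl⟩
  · exact ⟨(p : ℤ) ^ m, 0, by simp⟩
  · exact ⟨1, m, by simp⟩

theorem intCast_mem_Zinv (k : ℤ) : (k : ℚ) ∈ Zinv p := ⟨k, 0, by simp⟩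

/-- The group `UTₙ(ℤ[1/p])` of upper unitriangular matrices. -/
def UT (n p : ℕ) [Fact p.Prime] : Subgroup (GL (Fin n) (Zinv p)) where
  carrier := {g | (∀ i j, j < i → g.1 i j = 0) ∧ ∀ i, g.1 i i = 1}
  one_mem' := by
    refine ⟨fun i j h => ?_, fun i => ?_⟩
    · simp [h.ne']
    · simp
  mul_mem' := by
    rintro a b ⟨ha, ha'⟩ ⟨hb, hb'⟩
    refine ⟨fun i j h => ?_, fun i => ?_⟩
    · rw [Units.val_mul, Matrix.mul_apply]
      refine Finset.sum_eq_zero fun k _ => ?_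
      rcases lt_or_ge k i with hk | hk
      · rw [ha _ _ hk, zero_mul]
      · rw [hb _ _ (h.trans_le hk), mul_zero]
    · rw [Units.val_mul, Matrix.mul_apply, Finset.sum_eq_single i]
      · rw [ha', hb', one_mul]
      · intro k _ hk
        rcases lt_or_gt_of_ne hk with h | h
        · rw [ha _ _ h, zero_mul]
        · rw [hb _ _ h, mul_zero]
      · simp
  inv_mem' := by
    rintro a ⟨ha, ha'⟩
    have hinv : ∀ i j, j < i → (a⁻¹).1 i j = 0 := by
      have hbt : Matrix.BlockTriangular a.1 (id : Fin n → Fin n) := fun i j h => ha i j h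
      let _ : Invertible a.1 := a.invertible
      have h2 := Matrix.blockTriangular_inv_of_blockTriangular hbt
      intro i j h
      have h3 := h2 (i := i) (j := j) h
      rwa [← Matrix.coe_units_inv] at h3
    refine ⟨hinv, fun i => ?_⟩
    have h1 : (a.1 * (a⁻¹).1) i i = 1 := by
      rw [← Units.val_mul, mul_inv_cancel]; simp
    rw [Matrix.mul_apply, Finset.sum_eq_single i] at h1
    · rwa [ha', one_mul] at h1
    · intro k _ hk
      rcases lt_or_gt_of_ne hk with h | h
      · rw [ha _ _ h, zero_mul]
      · rw [hinv _ _ h, mul_zero]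
    · simp

/-- The upper unitriangular matrix whose entries above the diagonal are `c i j`. -/
def mkUT (c : Fin n → Fin n → Zinv p) : UT n p :=
  ⟨Matrix.GeneralLinearGroup.mk''
      (Matrix.of fun i j => if i < j then c i j else if i = j then 1 else 0)
      (by
        rw [Matrix.det_of_isUpperTriangular]
        · simp
        · intro i j (h : j < i)
          simp [h.not_gt, h.ne']),
    by
      refine ⟨fun i j h => ?_, fun i => ?_⟩
      · change (if i < j then c i j else if i = j then 1 else 0) = 0
        simp [h.not_gt, h.ne']
      · change (if i < i then c i i else if i = i then 1 else 0) = 1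
        simp⟩

/-- The prime `p` as a unit of `ℤ[1/p]`. -/
def pUnit (p : ℕ) [Fact p.Prime] : (Zinv p)ˣ where
  val := ⟨p, ⟨p, 0, by simp⟩⟩
  inv := ⟨(p : ℚ)⁻¹, ⟨1, 1, by simp⟩⟩
  val_inv := by
    have hp : (p : ℚ) ≠ 0 := by exact_mod_cast (Fact.out : p.Prime).ne_zero
    exact Subtype.ext (mul_inv_cancel₀ hp)
  inv_val := by
    have hp : (p : ℚ) ≠ 0 := by exact_mod_cast (Fact.out : p.Prime).ne_zero
    exact Subtype.ext (inv_mul_cancel₀ hp)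

/-- The diagonal matrix `diag(p ^ x₁, …, p ^ xₙ)`, as a homomorphism in `x ∈ ℤⁿ`. -/
def diagHom (n p : ℕ) [Fact p.Prime] :
    Multiplicative (Fin n → ℤ) →* GL (Fin n) (Zinv p) where
  toFun x :=
    { val := Matrix.diagonal fun i => ((pUnit p ^ (x.toAdd i) : (Zinv p)ˣ) : Zinv p)
      inv := Matrix.diagonal fun i => ((pUnit p ^ (-(x.toAdd i)) : (Zinv p)ˣ) : Zinv p)
      val_inv := by
        rw [Matrix.diagonal_mul_diagonal, ← Matrix.diagonal_one]
        congr 1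
        funext i
        rw [← Units.val_mul, ← zpow_add, add_neg_cancel, zpow_zero, Units.val_one]
      inv_val := by
        rw [Matrix.diagonal_mul_diagonal, ← Matrix.diagonal_one]
        congr 1
        funext i
        rw [← Units.val_mul, ← zpow_add, neg_add_cancel, zpow_zero, Units.val_one] }
  map_one' := by
    ext i j : 2
    simp [Matrix.one_apply, Matrix.diagonal_apply]
  map_mul' x y := by
    apply Units.ext
    change Matrix.diagonal _ = Matrix.diagonal _ * Matrix.diagonal _
    rw [Matrix.diagonal_mul_diagonal]
    congr 1
    funext i
    rw [← Units.val_mul, ← zpow_add, toAdd_mul, Pi.add_apply]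

theorem diagHom_conj_mem (x : Multiplicative (Fin n → ℤ)) {g : GL (Fin n) (Zinv p)}
    (hg : g ∈ UT n p) : diagHom n p x * g * (diagHom n p x)⁻¹ ∈ UT n p := by
  have key : ∀ i j, (diagHom n p x * g * (diagHom n p x)⁻¹).1 i j =
      ((pUnit p ^ (x.toAdd i) : (Zinv p)ˣ) : Zinv p) * g.1 i j *
        ((pUnit p ^ (-(x.toAdd j)) : (Zinv p)ˣ) : Zinv p) := by
    intro i j
    change (Matrix.diagonal (fun i => ((pUnit p ^ (x.toAdd i) : (Zinv p)ˣ) : Zinv p)) * g.1 *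
      Matrix.diagonal (fun i => ((pUnit p ^ (-(x.toAdd i)) : (Zinv p)ˣ) : Zinv p))) i j = _
    rw [Matrix.mul_diagonal, Matrix.diagonal_mul]
  refine ⟨fun i j h => ?_, fun i => ?_⟩
  · rw [key, hg.1 i j h, mul_zero, zero_mul]
  · rw [key, hg.2 i, mul_one, ← Units.val_mul, ← zpow_add, add_neg_cancel, zpow_zero,
      Units.val_one]

theorem diagHom_mem_normalizer (x : Multiplicative (Fin n → ℤ)) :
    diagHom n p x ∈ Subgroup.normalizer (UT n p : Set (GL (Fin n) (Zinv p))) := by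
  rw [Subgroup.mem_normalizer_iff]
  intro g
  refine ⟨fun hg => diagHom_conj_mem x hg, fun hg => ?_⟩
  have h := diagHom_conj_mem x⁻¹ hg
  rw [map_inv] at h
  have e : (diagHom n p x)⁻¹ * (diagHom n p x * g * (diagHom n p x)⁻¹) *
      ((diagHom n p x)⁻¹)⁻¹ = g := by group
  rwa [e] at h

/-- The action `ζₓ(f) = X f X⁻¹`, `X = diag(p ^ x₁, …, p ^ xₙ)`, of `ℤⁿ` on `UTₙ(ℤ[1/p])`. -/
def zeta (n p : ℕ) [Fact p.Prime] : Multiplicative (Fin n → ℤ) →* MulAut (UT n p) :=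
  (UT n p).normalizerMonoidHom.comp ((diagHom n p).codRestrict _ diagHom_mem_normalizer)

/-- The semidirect product `ℤⁿ ⋉ UTₙ(ℤ[1/p])`. The element written `(x, f)` on paper has
`x = g.right` and `f = g.left`, and `(x, f) (y, g) = (x + y, f ζₓ(g))`. -/
abbrev G (n p : ℕ) [Fact p.Prime] : Type :=
  UT n p ⋊[zeta n p] Multiplicative (Fin n → ℤ)

/-- `G` is a discrete group: every subset is measurable. -/
instance : MeasurableSpace (G n p) := ⊤

/-- The coordinate `xᵢ` of `g = (x, f)`. -/
def disp (g : G n p) (i : Fin n) : ℤ := g.right.toAdd i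

/-- The entry `fᵢⱼ` of `g = (x, f)`, as a rational number. -/
def entry (g : G n p) (i j : Fin n) : ℚ := ((g.left.1.1 i j : Zinv p) : ℚ)

/-- The standard generators: the unit vectors `eᵢ` of `ℤⁿ` (that is, `diag(1, …, p, …, 1)`), and
the elementary matrices with a single entry `1` above the diagonal. -/
def gens (n p : ℕ) [Fact p.Prime] : Set (G n p) :=
  {g | ∃ i : Fin n, g = ⟨1, Multiplicative.ofAdd (Pi.single i 1)⟩} ∪
  {g | ∃ r s : Fin n, r < s ∧
    g = ⟨mkUT fun i j => if i = r ∧ j = s then 1 else 0, 1⟩}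

/-- Word length with respect to the standard generators and their inverses (it would be `⊤` for an
element that is not a word in the generators). -/
def wordLength (g : G n p) : ℕ∞ :=
  ⨅ (l : List (G n p)) (_ : (∀ s ∈ l, s ∈ gens n p ∨ s⁻¹ ∈ gens n p) ∧ l.prod = g),
    (l.length : ℕ∞)

/-! ### The displacement matrix -/

/-- Finite first moment with respect to word length. -/
def FiniteFirstMoment (μ : Measure (G n p)) : Prop :=
  ∫⁻ g, (wordLength g : ℝ≥0∞) ∂μ < ∞

/-- The group generated by the support of `μ` is non-abelian. -/
def SupportNonabelian (μ : Measure (G n p)) : Prop :=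
  ∃ a ∈ Subgroup.closure {g : G n p | μ {g} ≠ 0},
    ∃ b ∈ Subgroup.closure {g : G n p | μ {g} ≠ 0}, a * b ≠ b * a

/-- The mean of the coordinate `xᵢ` under `μ`. -/
def drift (μ : Measure (G n p)) (i : Fin n) : ℝ := ∫ g, (disp g i : ℝ) ∂μ

/-- The displacement matrix. -/
def D (μ : Measure (G n p)) (i j : Fin n) : ℝ := drift μ i - drift μ j

/-- All entries of the displacement matrix above the diagonal are non-zero. -/
def DispNonzero (μ : Measure (G n p)) : Prop := ∀ i j : Fin n, i < j → D μ i j ≠ 0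

/-- In each column, the entries of the displacement matrix above the diagonal have the same sign. -/
def ColumnConsistent (μ : Measure (G n p)) : Prop :=
  ∀ i i' j : Fin n, i < j → i' < j → SignType.sign (D μ i j) = SignType.sign (D μ i' j)

/-! ### The boundary -/

/-- The field `ℝ` (for `true`) or `ℚ_p` (for `false`). -/
def BEntry (p : ℕ) [Fact p.Prime] : Bool → Type
  | true => ℝ
  | false => ℚ_[p]

instance : (s : Bool) → TopologicalSpace (BEntry p s)
  | true => inferInstanceAs (TopologicalSpace ℝ)
  | false => inferInstanceAs (TopologicalSpace ℚ_[p])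

/-- The Borel `σ`-algebra. -/
instance (s : Bool) : MeasurableSpace (BEntry p s) := borel _

/-- The inclusion of `ℚ` in `ℝ` or `ℚ_p`. -/
def ofRat : (s : Bool) → ℚ → BEntry p s
  | true, q => (q : ℝ)
  | false, q => (q : ℚ_[p])

open Classical in
/-- Whether `Dᵢⱼ` is negative. -/
def isNeg (μ : Measure (G n p)) (i j : Fin n) : Bool := decide (D μ i j < 0)

/-- The space `Γ` of upper unitriangular matrices, given by their entries above the diagonal, where
the entry at `(i, j)` is real if `Dᵢⱼ < 0` and `p`-adic otherwise. -/
abbrev Boundary (μ : Measure (G n p)) : Type :=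
  (q : {q : Fin n × Fin n // q.1 < q.2}) → BEntry p (isNeg μ q.1.1 q.1.2)

/-! ### The approximation maps -/

theorem exists_padic_fract (x : ℚ_[p]) :
    ∃ q : ℚ, q ∈ Zinv p ∧ 0 ≤ q ∧ q < 1 ∧ ‖x - (q : ℚ_[p])‖ ≤ 1 := by
  have hp0 : (p : ℚ_[p]) ≠ 0 := by exact_mod_cast (Fact.out : p.Prime).ne_zero
  have hp1 : (1 : ℝ) < p := by exact_mod_cast (Fact.out : p.Prime).one_lt
  obtain ⟨k, hk⟩ := pow_unbounded_of_one_lt ‖x‖ hp1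
  have hu : ‖(p : ℚ_[p]) ^ k * x‖ ≤ 1 := by
    rw [norm_mul, norm_pow, Padic.norm_p, inv_pow]
    rw [inv_mul_le_iff₀ (by positivity)]
    linarith
  set u : ℤ_[p] := ⟨(p : ℚ_[p]) ^ k * x, hu⟩ with hudef
  refine ⟨(u.appr k : ℚ) / (p : ℚ) ^ k, ⟨(u.appr k : ℤ), k, by simp⟩, by positivity, ?_, ?_⟩
  · have : (0 : ℚ) < (p : ℚ) ^ k := by
      have := (Fact.out : p.Prime).pos
      positivity
    rw [div_lt_one this]
    exact_mod_cast u.appr_lt k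
  · have h := PadicInt.appr_spec k u
    rw [← PadicInt.norm_le_pow_iff_mem_span_pow] at h
    have e : x - (((u.appr k : ℚ) / (p : ℚ) ^ k : ℚ) : ℚ_[p]) =
        ((u - (u.appr k : ℤ_[p]) : ℤ_[p]) : ℚ_[p]) / (p : ℚ_[p]) ^ k := by
      rw [eq_div_iff (pow_ne_zero k hp0), PadicInt.coe_sub, hudef]
      push_cast
      rw [sub_mul, div_mul_cancel₀ _ (pow_ne_zero k hp0), mul_comm x]
    rw [e, norm_div, norm_pow, Padic.norm_p, inv_pow, div_inv_eq_mul, PadicInt.padic_norm_e_of_padicInt]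
    calc _ ≤ (p : ℝ) ^ (-(k : ℤ)) * (p : ℝ) ^ k := by gcongr
      _ = 1 := by
        rw [zpow_neg, zpow_natCast]
        exact inv_mul_cancel₀ (by positivity)

/-- The `p`-adic fractional part `{x}`: the unique element of `ℤ[1/p] ∩ [0, 1)` that differs from
`x` by a `p`-adic integer. -/
def padicFract (x : ℚ_[p]) : ℚ := Classical.choose (exists_padic_fract x)

theorem padicFract_mem (x : ℚ_[p]) : padicFract x ∈ Zinv p :=
  (Classical.choose_spec (exists_padic_fract x)).1

theorem padicFract_spec (x : ℚ_[p]) :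
    0 ≤ padicFract x ∧ padicFract x < 1 ∧ ‖x - (padicFract x : ℚ_[p])‖ ≤ 1 :=
  (Classical.choose_spec (exists_padic_fract x)).2

/-- `p ^ M ⌊p ^ (-M) b⌋` for real `b`, and `p ^ M {p ^ (-M) b}` for `p`-adic `b`. -/
def trunc (M : ℤ) : (s : Bool) → BEntry p s → Zinv p
  | true, b => ⟨(p : ℚ) ^ M * (⌊(p : ℝ) ^ (-M) * (show ℝ from b)⌋ : ℤ),
      (Zinv p).mul_mem (zpow_mem_Zinv M) (intCast_mem_Zinv _)⟩
  | false, b => ⟨(p : ℚ) ^ M * padicFract ((p : ℚ_[p]) ^ (-M) * (show ℚ_[p] from b)),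
      (Zinv p).mul_mem (zpow_mem_Zinv M) (padicFract_mem _)⟩

/-- The vector `t⁽ᵐ⁾ = (⌊m · drift₁⌋, …, ⌊m · driftₙ⌋)`. -/
def tvec (μ : Measure (G n p)) (m : ℕ) (i : Fin n) : ℤ := ⌊(m : ℝ) * drift μ i⌋

/-- The unitriangular matrix `T⁽ᵐ⁾(b)`. -/
def Tmat (μ : Measure (G n p)) (m : ℕ) (b : Boundary μ) : UT n p :=
  mkUT fun i j => if h : i < j then
    trunc (tvec μ m i - tvec μ m j) (isNeg μ i j) (b ⟨(i, j), h⟩) else 0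

/-- The approximation map `Π⁽ᵐ⁾(b) = (t⁽ᵐ⁾, T⁽ᵐ⁾(b))`. -/
def approx (μ : Measure (G n p)) (m : ℕ) (b : Boundary μ) : G n p :=
  ⟨Tmat μ m b, Multiplicative.ofAdd (tvec μ m)⟩

/-! ### The right random walk -/

/-- The position `(y⁽ᵐ⁾, φ⁽ᵐ⁾) = X₁ X₂ ⋯ Xₘ` of the right random walk after `m` steps
(the increments are indexed from `0`). -/
def walk {Ω : Type*} (X : ℕ → Ω → G n p) : ℕ → Ω → G n p
  | 0, _ => 1
  | m + 1, ω => walk X m ω * X m ω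

/-- The matrices `φ⁽ᵐ⁾` of the trajectory `g` converge to the boundary point `b`, each entry above
the diagonal in `ℝ` or in `ℚ_p`. -/
def ConvergesTo (μ : Measure (G n p)) (g : ℕ → G n p) (b : Boundary μ) : Prop :=
  ∀ q : {q : Fin n × Fin n // q.1 < q.2},
    Tendsto (fun m => (ofRat _ (entry (g m) q.1.1 q.1.2) : BEntry p (isNeg μ q.1.1 q.1.2)))
      atTop (𝓝 (b q))

end SolvWalk

end

noncomputable section

namespace SolvWalk

variable {p : ℕ} [Fact p.Prime] {n : ℕ}

/-! ### Matrix entries in the group -/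

/-! The linear bound needs no cancellation between the walk and its approximation: by the triangle
inequality it suffices that both have length `O(m)`. For the walk this is the strong law of large
numbers applied to the lengths of the increments (`hasWord_walk`, `ae_tendsto_average`). For the
approximation it comes from the exponential distortion of the unipotent part: conjugation by
`diagElt` multiplies an elementary entry by a power of `p`, so an integer below `p ^ l` is spelled
by its base-`p` digits with `O(l)` letters (`hasWord_elem_natCast`). Truncation leaves entries of
the form (power of `p`) times (integer below `p ^ O(m)`), see `exists_hasWord_trunc`, and a
unitriangular matrix is a product of at most `n * n` elementary ones (`hasWord_mkUT`).

The substance is the convergence, `cauchySeq_entry`. Let `K` be `ℝ` or `ℚ_p` and `L = log ‖p‖`. One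
step of the walk adds to the entry in column `k` the terms `a l * p ^ (y l - y k) * (increment
entry)` with `l < k`. The power of `p` has norm about `exp (L (d l - d k) m)`. The increment entry
is subexponential, since entries are at most exponential in word length (`exists_norm_entry_le`) and
a finite first moment makes the lengths `o(m)` almost surely (`tendsto_div_zero_of_average`). Column
consistency puts every `L * d k`, `k < j`, below `L * d j`; with `c` in between, induction on `k <
j` bounds column `k` by `exp ((c - L d k + ε) m)`. In column `j` this exponent is negative, so the
increments are summable, and `K` is complete. -/

theorem UT_ext {f g : UT n p} (h : ∀ i j, f.1.1 i j = g.1.1 i j) : f = g :=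
  Subtype.ext (Units.ext (Matrix.ext h))

theorem mkUT_apply (c : Fin n → Fin n → Zinv p) (i j : Fin n) :
    (mkUT c).1.1 i j = if i < j then c i j else if i = j then 1 else 0 := rfl

theorem UT_mul_apply (f g : UT n p) (i j : Fin n) :
    (f * g).1.1 i j = ∑ k, f.1.1 i k * g.1.1 k j := rfl

theorem zeta_apply (x : Multiplicative (Fin n → ℤ)) (f : UT n p) (i j : Fin n) :
    (zeta n p x f).1.1 i j = ((pUnit p ^ (x.toAdd i) : (Zinv p)ˣ) : Zinv p) * f.1.1 i j *
      ((pUnit p ^ (-(x.toAdd j)) : (Zinv p)ˣ) : Zinv p) := by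
  change (Matrix.diagonal (fun i => ((pUnit p ^ (x.toAdd i) : (Zinv p)ˣ) : Zinv p)) * f.1.1 *
    Matrix.diagonal (fun i => ((pUnit p ^ (-(x.toAdd i)) : (Zinv p)ˣ) : Zinv p))) i j = _
  rw [Matrix.mul_diagonal, Matrix.diagonal_mul]

theorem coe_pUnit_zpow (k : ℤ) : (((pUnit p ^ k : (Zinv p)ˣ) : Zinv p) : ℚ) = (p : ℚ) ^ k := by
  have h := map_zpow (Units.map ((Zinv p).subtype : Zinv p →* ℚ)) (pUnit p) k
  have h' := congrArg (fun u : ℚˣ => (u : ℚ)) h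
  rw [Units.val_zpow_eq_zpow_val] at h'
  exact h'

theorem natCast_p_ne_zero : (p : ℚ) ≠ 0 := by exact_mod_cast (Fact.out : p.Prime).ne_zero

theorem entry_of_lt (g : G n p) {i j : Fin n} (h : j < i) : entry g i j = 0 := by
  rw [entry, g.left.2.1 i j h]; rfl

theorem entry_diag (g : G n p) (i : Fin n) : entry g i i = 1 := by
  rw [entry, g.left.2.2 i]; rfl

theorem entry_one (i j : Fin n) : entry (1 : G n p) i j = if i = j then 1 else 0 := by
  change (((1 : Matrix (Fin n) (Fin n) (Zinv p)) i j : Zinv p) : ℚ) = _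
  rw [Matrix.one_apply]
  split_ifs <;> rfl

theorem disp_one (i : Fin n) : disp (1 : G n p) i = 0 := rfl

theorem disp_mul (g h : G n p) (i : Fin n) : disp (g * h) i = disp g i + disp h i := rfl

theorem entry_mul (g h : G n p) (i j : Fin n) :
    entry (g * h) i j =
      ∑ k, entry g i k * (p : ℚ) ^ (disp g k - disp g j) * entry h k j := by
  change ((((g.left * zeta n p g.right h.left).1.1 i j : Zinv p)) : ℚ) = _
  rw [UT_mul_apply, AddSubmonoidClass.coe_finsetSum]
  refine Finset.sum_congr rfl fun k _ => ?_
  rw [zeta_apply]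
  push_cast
  rw [coe_pUnit_zpow, coe_pUnit_zpow, sub_eq_add_neg, zpow_add₀ natCast_p_ne_zero]
  simp only [entry, disp]
  ring

/-! ### Elementary and diagonal elements -/

/-- The elementary unitriangular matrix with the entry `a` at `(r, s)`. -/
def elemUT (r s : Fin n) (a : Zinv p) : UT n p := mkUT fun i j => if i = r ∧ j = s then a else 0

/-- The element `(0, I + a E_{rs})`. -/
def elem (r s : Fin n) (a : Zinv p) : G n p := ⟨elemUT r s a, 1⟩

/-- The element `(x, I)`. -/
def diagElt (p : ℕ) [Fact p.Prime] (x : Fin n → ℤ) : G n p := ⟨1, Multiplicative.ofAdd x⟩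

/-- The tests are phrased on the column index so that `Finset.sum_ite_eq'` collapses the sum in a
product with this matrix on the left. -/
theorem elemUT_apply {r s : Fin n} (h : r < s) (a : Zinv p) (i j : Fin n) :
    (elemUT r s a).1.1 i j = (if j = s then (if i = r then a else 0) else 0) +
      if j = i then 1 else 0 := by
  rw [elemUT, mkUT_apply]
  rcases lt_trichotomy i j with hij | rfl | hij
  · simp only [if_pos hij, hij.ne', if_false, add_zero]
    by_cases h1 : i = r <;> by_cases h2 : j = s <;> simp [h1, h2]
  · have : ¬ (i = s ∧ i = r) := fun ⟨h1, h2⟩ => h.ne (h2.symm.trans h1)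
    by_cases h1 : i = r <;> by_cases h2 : i = s <;> simp_all
  · have : ¬ (j = s ∧ i = r) := fun ⟨h1, h2⟩ => by subst h1 h2; exact lt_asymm h hij
    rw [if_neg hij.not_gt, if_neg hij.ne', if_neg hij.ne, add_zero, ← ite_and, if_neg this]

theorem elemUT_mul_apply {r s : Fin n} (h : r < s) (a : Zinv p) (f : UT n p) (i j : Fin n) :
    (elemUT r s a * f).1.1 i j = (if i = r then a * f.1.1 s j else 0) + f.1.1 i j := by
  rw [UT_mul_apply]
  simp only [elemUT_apply h, add_mul, ite_mul, zero_mul, one_mul, Finset.sum_add_distrib,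
    Finset.sum_ite_eq', Finset.mem_univ, if_true]

theorem elem_add {r s : Fin n} (h : r < s) (a b : Zinv p) :
    (elem r s (a + b) : G n p) = elem r s a * elem r s b := by
  refine SemidirectProduct.ext ?_ (mul_one 1).symm
  change elemUT r s (a + b) = elemUT r s a * zeta n p 1 (elemUT r s b)
  rw [map_one, MulAut.one_apply]
  refine UT_ext fun i j => ?_
  rw [elemUT_mul_apply h, elemUT_apply h, elemUT_apply h, elemUT_apply h]
  by_cases h1 : i = r <;> by_cases h2 : j = s <;> simp [h1, h2, h.ne']

theorem elem_zero {r s : Fin n} (h : r < s) : (elem r s 0 : G n p) = 1 := by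
  have := elem_add (p := p) h 0 0
  rwa [add_zero, left_eq_mul] at this

theorem elem_neg {r s : Fin n} (h : r < s) (a : Zinv p) :
    (elem r s (-a) : G n p) = (elem r s a)⁻¹ := by
  rw [eq_inv_iff_mul_eq_one, ← elem_add h, neg_add_cancel, elem_zero h]

theorem diagElt_add (x y : Fin n → ℤ) : diagElt p (x + y) = diagElt p x * diagElt p y := by
  refine SemidirectProduct.ext ?_ rfl
  change (1 : UT n p) = 1 * zeta n p _ 1
  rw [map_one, mul_one]

theorem diagElt_zero : (diagElt p 0 : G n p) = 1 := rfl

theorem diagElt_neg (x : Fin n → ℤ) : diagElt p (-x) = (diagElt p x)⁻¹ := by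
  rw [eq_inv_iff_mul_eq_one, ← diagElt_add, neg_add_cancel, diagElt_zero]

/-- The source of the distortion: a factor `p ^ k` on an entry costs only `2 |k|` letters. -/
theorem diagElt_conj_elem {r s : Fin n} (h : r < s) (k : ℤ) (a : Zinv p) :
    diagElt p (Pi.single r k) * elem r s a * (diagElt p (Pi.single r k))⁻¹ =
      elem r s (((pUnit p ^ k : (Zinv p)ˣ) : Zinv p) * a) := by
  rw [mul_inv_eq_iff_eq_mul]
  refine SemidirectProduct.ext ?_ ?_
  · change 1 * zeta n p _ (elemUT r s a) = elemUT r s _ * zeta n p 1 1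
    rw [(zeta n p 1).map_one, mul_one, one_mul]
    refine UT_ext fun i j => ?_
    change (zeta n p (Multiplicative.ofAdd (Pi.single r k)) _).1.1 i j = _
    rw [zeta_apply, elemUT_apply h, elemUT_apply h, toAdd_ofAdd]
    rcases eq_or_ne j i with rfl | hji
    · by_cases h1 : j = s
      · simp [h1, h.ne']
      · simp [h1, -Units.val_zpow_eq_zpow_val]
    · by_cases h1 : j = s <;> by_cases h2 : i = r <;> simp [h1, h2, h.ne', hji]
      all_goals aesop
  · change (Multiplicative.ofAdd _) * 1 = 1 * Multiplicative.ofAdd _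
    rw [mul_one, one_mul]

theorem diagElt_single_one_mem_gens (i : Fin n) : diagElt p (Pi.single i 1) ∈ gens n p :=
  Or.inl ⟨i, rfl⟩

theorem elem_one_mem_gens {r s : Fin n} (h : r < s) : (elem r s 1 : G n p) ∈ gens n p :=
  Or.inr ⟨r, s, h, rfl⟩

theorem eq_elem_mul_diagElt (f : UT n p) (x : Fin n → ℤ) :
    (⟨f, Multiplicative.ofAdd x⟩ : G n p) = (⟨f, 1⟩ : G n p) * diagElt p x := by
  refine SemidirectProduct.ext ?_ (one_mul _).symm
  change f = f * zeta n p 1 1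
  rw [map_one, mul_one]

/-! ### Words in the generators -/

/-- `g` is a word of length at most `N` in the generators and their inverses. -/
def HasWord (g : G n p) (N : ℕ) : Prop :=
  ∃ l : List (G n p), (∀ s ∈ l, s ∈ gens n p ∨ s⁻¹ ∈ gens n p) ∧ l.prod = g ∧ l.length ≤ N

theorem hasWord_iff {g : G n p} {N : ℕ} : wordLength g ≤ N ↔ HasWord g N := by
  constructor
  · intro h
    by_contra hN
    have : ((N + 1 : ℕ) : ℕ∞) ≤ wordLength g := by
      refine le_iInf₂ fun l hl => ?_
      by_contra h'
      refine hN ⟨l, hl.1, hl.2, ?_⟩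
      rw [not_le, Nat.cast_lt] at h'
      omega
    have := this.trans h
    rw [Nat.cast_le] at this
    omega
  · rintro ⟨l, h1, h2, h3⟩
    exact (iInf₂_le l ⟨h1, h2⟩).trans (by exact_mod_cast h3)

theorem HasWord.mono {g : G n p} {N M : ℕ} (h : HasWord g N) (hNM : N ≤ M) : HasWord g M := by
  obtain ⟨l, h1, h2, h3⟩ := h
  exact ⟨l, h1, h2, h3.trans hNM⟩

theorem hasWord_one : HasWord (1 : G n p) 0 := ⟨[], by simp, rfl, le_rfl⟩

theorem HasWord.of_mem {g : G n p} (h : g ∈ gens n p) : HasWord g 1 :=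
  ⟨[g], by simpa using Or.inl h, by simp, le_rfl⟩

theorem HasWord.mul {g h : G n p} {N M : ℕ} (hg : HasWord g N) (hh : HasWord h M) :
    HasWord (g * h) (N + M) := by
  obtain ⟨l, h1, h2, h3⟩ := hg
  obtain ⟨l', h1', h2', h3'⟩ := hh
  refine ⟨l ++ l', fun s hs => ?_, by rw [List.prod_append, h2, h2'], ?_⟩
  · rcases List.mem_append.1 hs with hs | hs
    exacts [h1 s hs, h1' s hs]
  · rw [List.length_append]; omega

theorem HasWord.inv {g : G n p} {N : ℕ} (hg : HasWord g N) : HasWord g⁻¹ N := by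
  obtain ⟨l, h1, h2, h3⟩ := hg
  refine ⟨(l.map (·⁻¹)).reverse, fun s hs => ?_, by rw [← List.prod_inv_reverse, h2], by simpa⟩
  rw [List.mem_reverse, List.mem_map] at hs
  obtain ⟨t, ht, rfl⟩ := hs
  rw [inv_inv]
  exact (h1 t ht).symm

theorem HasWord.pow {g : G n p} {N : ℕ} (hg : HasWord g N) (k : ℕ) : HasWord (g ^ k) (k * N) := by
  induction k with
  | zero => simpa using hasWord_one
  | succ k ih => rw [pow_succ, Nat.succ_mul]; exact ih.mul hg

theorem hasWord_diagElt_single (i : Fin n) (k : ℤ) :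
    HasWord (diagElt p (Pi.single i k)) k.natAbs := by
  have hnat : ∀ m : ℕ, HasWord (diagElt p (Pi.single i (m : ℤ))) m := by
    intro m
    have e : diagElt p (Pi.single i (m : ℤ)) = diagElt p (Pi.single i 1) ^ m := by
      induction m with
      | zero => simp [diagElt_zero]
      | succ m ih =>
        rw [pow_succ, ← ih, ← diagElt_add, ← Pi.single_add]
        push_cast; rfl
    rw [e]
    simpa using (HasWord.of_mem (diagElt_single_one_mem_gens (p := p) i)).pow m
  rcases Int.eq_nat_or_neg k with ⟨m, rfl | rfl⟩
  · simpa using hnat m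
  · rw [Pi.single_neg, diagElt_neg]
    simpa using (hnat m).inv

theorem hasWord_diagElt (x : Fin n → ℤ) {B : ℕ} (hB : ∀ i, (x i).natAbs ≤ B) :
    HasWord (diagElt p x) (n * B) := by
  have h : ∀ S : Finset (Fin n),
      HasWord (diagElt p (∑ i ∈ S, Pi.single i (x i))) (S.card * B) := by
    intro S
    induction S using Finset.induction_on with
    | empty => simpa [diagElt_zero] using hasWord_one
    | insert a S ha ih =>
      rw [Finset.sum_insert ha, Finset.card_insert_of_notMem ha, diagElt_add, Nat.succ_mul,
        add_comm]
      exact ((hasWord_diagElt_single a (x a)).mono (hB a)).mul ih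
  simpa [Finset.univ_sum_single] using h Finset.univ

theorem hasWord_elem_zpow_mul {r s : Fin n} (h : r < s) {a : Zinv p} {N : ℕ}
    (ha : HasWord (elem r s a) N) (k : ℤ) :
    HasWord (elem r s (((pUnit p ^ k : (Zinv p)ˣ) : Zinv p) * a)) (N + 2 * k.natAbs) := by
  rw [← diagElt_conj_elem h]
  have hk := hasWord_diagElt_single (p := p) r k
  exact ((hk.mul ha).mul hk.inv).mono (by omega)

theorem hasWord_elem_natCast_small {r s : Fin n} (h : r < s) (c : ℕ) :
    HasWord (elem r s (c : Zinv p)) c := by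
  induction c with
  | zero => rw [Nat.cast_zero, elem_zero h]; exact hasWord_one
  | succ c ih => rw [Nat.cast_succ, elem_add h]; exact ih.mul (.of_mem (elem_one_mem_gens h))

/-- Horner's scheme in base `p`: multiplying by `p` is a conjugation costing two letters, and adding
the last digit costs fewer than `p`. -/
theorem hasWord_elem_natCast {r s : Fin n} (h : r < s) (l : ℕ) :
    ∀ c : ℕ, c < p ^ l → HasWord (elem r s (c : Zinv p)) ((p + 2) * l) := by
  induction l with
  | zero =>
    intro c hc
    obtain rfl : c = 0 := by simpa using hc
    rw [Nat.cast_zero, elem_zero h]; exact hasWord_one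
  | succ l ih =>
    intro c hc
    have hp : 0 < p := (Fact.out : p.Prime).pos
    have h1 := ih (c / p) (by rw [Nat.div_lt_iff_lt_mul hp, ← pow_succ]; exact hc)
    have h2 := hasWord_elem_zpow_mul h h1 1
    have h3 := h2.mul (hasWord_elem_natCast_small h (c % p))
    rw [← elem_add h] at h3
    have e : ((pUnit p ^ (1 : ℤ) : (Zinv p)ˣ) : Zinv p) * ((c / p : ℕ) : Zinv p) +
        ((c % p : ℕ) : Zinv p) = (c : Zinv p) := by
      rw [zpow_one]
      change ((p : Zinv p)) * _ + _ = _
      exact_mod_cast congrArg (Nat.cast : ℕ → Zinv p) (Nat.div_add_mod c p)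
    rw [e] at h3
    refine h3.mono ?_
    have := Nat.mod_lt c hp
    simp only [Int.natAbs_one]
    nlinarith

theorem hasWord_elem_intCast {r s : Fin n} (h : r < s) (l : ℕ) (c : ℤ) (hc : c.natAbs < p ^ l) :
    HasWord (elem r s (c : Zinv p)) ((p + 2) * l) := by
  have hw := hasWord_elem_natCast h l _ hc
  rcases Int.natAbs_eq c with hc' | hc'
  · rw [hc', Int.cast_natCast]; exact hw
  · rw [hc', Int.cast_neg, elem_neg h, Int.cast_natCast]; exact hw.inv

/-- Left multiplication adds `a` times row `s` to row `r`; when row `s` is still trivial, only the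
entry at `(r, s)` changes. -/
theorem elemUT_mul_mkUT {r s : Fin n} (h : r < s) (a : Zinv p) (c : Fin n → Fin n → Zinv p)
    (hc : ∀ j, s < j → c s j = 0) :
    elemUT r s a * mkUT c = mkUT fun i j => c i j + if i = r ∧ j = s then a else 0 := by
  refine UT_ext fun i j => ?_
  rw [elemUT_mul_apply h, mkUT_apply, mkUT_apply, mkUT_apply]
  rcases lt_trichotomy s j with hs | rfl | hs
  · simp [hs, hs.ne', hc j hs]
  · by_cases h1 : i = r
    · subst h1; simp [h, add_comm]
    · simp [h1]
  · simp [hs.not_gt, hs.ne', hs.ne]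

theorem hasWord_mkUT {c : Fin n → Fin n → Zinv p} {N : ℕ}
    (hc : ∀ r s, r < s → HasWord (elem r s (c r s)) N) :
    HasWord (⟨mkUT c, 1⟩ : G n p) (n * n * N) := by
  -- The lexicographic order puts the column first. When the entry at `(r, s)` is inserted as the
  -- largest one, no entry in a column beyond `s` is present yet, so row `s` is trivial and the
  -- elementary factors do not interfere.
  have key : ∀ S : Finset (Fin n ×ₗ Fin n), (∀ a ∈ S, (ofLex a).2 < (ofLex a).1) →
      HasWord (⟨mkUT fun i j => if toLex (j, i) ∈ S then c i j else 0, 1⟩ : G n p)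
        (S.card * N) := by
    intro S
    induction S using Finset.induction_on_max with
    | empty =>
      intro _
      have e : (mkUT fun (i j : Fin n) => if toLex (j, i) ∈ (∅ : Finset (Fin n ×ₗ Fin n))
          then c i j else 0) = 1 := by
        refine UT_ext fun i j => ?_
        change _ = (1 : Matrix (Fin n) (Fin n) (Zinv p)) i j
        rw [mkUT_apply, Matrix.one_apply]
        rcases lt_trichotomy i j with h | h | h
        · simp [h, h.ne]
        · simp [h]
        · simp [h.ne', h.not_gt]
      rw [e]
      simpa using hasWord_one
    | insert a S ha ih =>
      intro hS
      obtain ⟨⟨s, r⟩, rfl⟩ := toLex.surjective a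
      have hrs : r < s := hS _ (Finset.mem_insert_self _ _)
      have hns : toLex (s, r) ∉ S := fun h => lt_irrefl _ (ha _ h)
      have h1 := (hc r s hrs).mul (ih fun a h => hS a (Finset.mem_insert_of_mem h))
      rw [Finset.card_insert_of_notMem hns, Nat.succ_mul, add_comm]
      convert h1 using 1
      refine SemidirectProduct.ext ?_ (mul_one 1).symm
      change _ = elemUT r s (c r s) * zeta n p 1 _
      rw [map_one, MulAut.one_apply, elemUT_mul_mkUT hrs]
      · refine congrArg mkUT (funext fun i => funext fun j => ?_)
        by_cases hij : i = r ∧ j = s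
        · obtain ⟨rfl, rfl⟩ := hij
          simp [hns]
        · have : toLex (j, i) ≠ toLex (s, r) := fun h => by
            have := toLex.injective h
            rw [Prod.mk.injEq] at this
            exact hij this.symm
          simp [hij, this]
      · intro j hj
        rw [if_neg]
        intro hmem
        have := ha _ hmem
        rw [Prod.Lex.toLex_lt_toLex] at this
        rcases this with h | h
        · exact lt_asymm h hj
        · exact hj.ne' h.1
  have h := key {a | (ofLex a).2 < (ofLex a).1} (fun a ha => (Finset.mem_filter.1 ha).2)
  have e : (mkUT fun i j => if toLex (j, i) ∈
      ({a | (ofLex a).2 < (ofLex a).1} : Finset (Fin n ×ₗ Fin n)) then c i j else 0) = mkUT c := by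
    refine UT_ext fun i j => ?_
    rw [mkUT_apply, mkUT_apply]
    split_ifs <;> simp_all
  rw [e] at h
  refine h.mono (Nat.mul_le_mul_right _ ((Finset.card_le_univ _).trans ?_))
  change Fintype.card (Fin n × Fin n) ≤ _
  simp

/-! ### Matrix entries are at most exponential in the word length -/

theorem HasWord.induction_left {C : G n p → ℕ → Prop} (h1 : C 1 0)
    (hmul : ∀ s g N, (s ∈ gens n p ∨ s⁻¹ ∈ gens n p) → C g N → C (s * g) (N + 1))
    {g : G n p} {N : ℕ} (hg : HasWord g N) : ∃ M ≤ N, C g M := by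
  obtain ⟨l, hl, rfl, hN⟩ := hg
  refine ⟨l.length, hN, ?_⟩
  clear hN
  induction l with
  | nil => exact h1
  | cons s l ih =>
    rw [List.prod_cons]
    exact hmul _ _ _ (hl s List.mem_cons_self) (ih fun t ht => hl t (List.mem_cons_of_mem _ ht))

theorem eq_of_mem_gens {s : G n p} (hs : s ∈ gens n p ∨ s⁻¹ ∈ gens n p) :
    (∃ i : Fin n, ∃ k : ℤ, |k| ≤ 1 ∧ s = diagElt p (Pi.single i k)) ∨
      ∃ i j : Fin n, ∃ k : ℤ, |k| ≤ 1 ∧ i < j ∧ s = elem i j (k : Zinv p) := by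
  rcases hs with (⟨i, h⟩ | ⟨i, j, hij, h⟩) | (⟨i, h⟩ | ⟨i, j, hij, h⟩)
  · exact Or.inl ⟨i, 1, by simp, h⟩
  · exact Or.inr ⟨i, j, 1, by simp, hij, by rw [Int.cast_one]; exact h⟩
  · refine Or.inl ⟨i, -1, by simp, ?_⟩
    rw [Pi.single_neg, diagElt_neg, ← inv_eq_iff_eq_inv]
    exact h
  · refine Or.inr ⟨i, j, -1, by simp, hij, ?_⟩
    rw [Int.cast_neg, Int.cast_one, elem_neg hij, ← inv_eq_iff_eq_inv]
    exact h

theorem abs_disp_gen_le {s : G n p} (hs : s ∈ gens n p ∨ s⁻¹ ∈ gens n p) (i : Fin n) :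
    |disp s i| ≤ 1 := by
  rcases eq_of_mem_gens hs with ⟨j, k, hk, rfl⟩ | ⟨_, _, _, _, _, rfl⟩
  · change |(Pi.single j k : Fin n → ℤ) i| ≤ 1
    by_cases h : i = j
    · subst h; simpa using hk
    · simp [h]
  · change |(0 : ℤ)| ≤ 1
    simp

theorem HasWord.abs_disp_le {g : G n p} {N : ℕ} (hg : HasWord g N) (i : Fin n) :
    |disp g i| ≤ N := by
  obtain ⟨M, hM, h⟩ := hg.induction_left (C := fun g N => |disp g i| ≤ N) (by simp [disp_one]) (by
    intro s g N hs h
    rw [disp_mul]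
    push_cast
    linarith [abs_add_le (disp s i) (disp g i), abs_disp_gen_le hs i])
  exact h.trans (by exact_mod_cast hM)

theorem norm_entry_gen_le {K : Type*} [NormedField K] {s : G n p} (hs : s ∈ gens n p ∨ s⁻¹ ∈ gens n p) (i j : Fin n) :
    ‖((entry s i j : ℚ) : K)‖ ≤ 1 := by
  rcases eq_of_mem_gens hs with ⟨_, k, hk, rfl⟩ | ⟨r, t, k, hk, hrt, rfl⟩
  · change ‖((entry (1 : G n p) i j : ℚ) : K)‖ ≤ 1
    rw [entry_one]
    split_ifs <;> simp
  · have hk' : ‖(k : K)‖ ≤ 1 := by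
      have : k = -1 ∨ k = 0 ∨ k = 1 := by rw [abs_le] at hk; omega
      rcases this with rfl | rfl | rfl <;> simp
    rw [entry]
    change ‖(((elemUT r t (k : Zinv p)).1.1 i j : ℚ) : K)‖ ≤ 1
    rw [elemUT, mkUT_apply]
    split_ifs <;> simp [hk']

theorem exists_norm_entry_le (n p : ℕ) [Fact p.Prime] (K : Type*) [NormedField K] [CharZero K] :
    ∃ B : ℝ, 1 ≤ B ∧ ∀ (g : G n p) (N : ℕ), HasWord g N →
      ∀ i j, ‖((entry g i j : ℚ) : K)‖ ≤ B ^ N := by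
  have hp : (p : K) ≠ 0 := by exact_mod_cast (Fact.out : p.Prime).ne_zero
  -- One bound for the norms of `p⁻¹`, `1` and `p`, whether `‖p‖` is above or below `1`. An entry of
  -- a generator times `g` is a sum of `n` terms, each at most `Q * Q` times the previous bound.
  set Q : ℝ := ‖(p : K)‖ + ‖(p : K)‖⁻¹ + 1 with hQ
  have hpos : 0 < ‖(p : K)‖ := norm_pos_iff.2 hp
  have hQ1 : 1 ≤ Q := by rw [hQ]; linarith [inv_pos.2 hpos]
  have hpow : ∀ z : ℤ, |z| ≤ 1 → ‖(p : K) ^ z‖ ≤ Q := by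
    intro z hz
    have : z = -1 ∨ z = 0 ∨ z = 1 := by rw [abs_le] at hz; omega
    rcases this with rfl | rfl | rfl <;> simp [hQ] <;> linarith [inv_pos.2 hpos]
  refine ⟨n * (Q * Q) + 1, by nlinarith [Nat.cast_nonneg (α := ℝ) n], fun g N hg => ?_⟩
  have hB : (1 : ℝ) ≤ n * (Q * Q) + 1 := by nlinarith [Nat.cast_nonneg (α := ℝ) n]
  obtain ⟨M, hM, h⟩ := hg.induction_left
    (C := fun g N => ∀ i j, ‖((entry g i j : ℚ) : K)‖ ≤ (n * (Q * Q) + 1) ^ N) (by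
      intro i j; rw [entry_one]; split_ifs <;> simp) (by
    intro s g N hs h i j
    rw [entry_mul, Rat.cast_sum]
    have hterm : ∀ k ∈ Finset.univ, ‖((entry s i k * (p : ℚ) ^ (disp s k - disp s j) *
        entry g k j : ℚ) : K)‖ ≤ Q * Q * (n * (Q * Q) + 1) ^ N := by
      intro k _
      push_cast
      rw [sub_eq_add_neg, zpow_add₀ hp, norm_mul, norm_mul, norm_mul]
      have a1 := norm_entry_gen_le (K := K) hs i k
      have a2 := hpow _ (abs_disp_gen_le hs k)
      have a3 := hpow (-disp s j) (by rw [abs_neg]; exact abs_disp_gen_le hs j)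
      have a4 := h k j
      calc _ ≤ 1 * (Q * Q) * (n * (Q * Q) + 1) ^ N := by gcongr
        _ = _ := by ring
    refine (norm_sum_le_of_le _ hterm).trans ?_
    rw [Finset.sum_const, Finset.card_univ, Fintype.card_fin, nsmul_eq_mul, pow_succ]
    have : 0 ≤ (n * (Q * Q) + 1) ^ N := by positivity
    nlinarith)
  exact fun i j => (h i j).trans (pow_le_pow_right₀ hB hM)

/-! ### The `p`-adic fractional part -/

/-- Only `p` can divide the denominator of `q`, and the norm bounds its exponent there. -/
theorem exists_int_of_norm_le {q : ℚ} (hq : q ∈ Zinv p) (k : ℕ)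
    (h : ‖(q : ℚ_[p])‖ ≤ (p : ℝ) ^ k) : ∃ c : ℤ, q * (p : ℚ) ^ k = c := by
  obtain ⟨a, r, rfl⟩ := hq
  have hp : (0 : ℝ) < p := by exact_mod_cast (Fact.out : p.Prime).pos
  have h1 : ‖((a * (p : ℤ) ^ k : ℤ) : ℚ_[p])‖ ≤ (p : ℝ) ^ (-(r : ℤ)) := by
    push_cast at h ⊢
    rw [norm_div, norm_pow, Padic.norm_p, div_le_iff₀ (by positivity)] at h
    rw [norm_mul, norm_pow, Padic.norm_p, zpow_neg, zpow_natCast]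
    calc _ ≤ (p : ℝ) ^ k * (p : ℝ)⁻¹ ^ r * (p : ℝ)⁻¹ ^ k := by gcongr
      _ = ((p : ℝ) ^ r)⁻¹ := by rw [inv_pow, inv_pow]; field_simp
  rw [Padic.norm_int_le_pow_iff_dvd] at h1
  obtain ⟨c, hc⟩ := h1
  refine ⟨c, ?_⟩
  have hc' : (a : ℚ) * (p : ℚ) ^ k = (p : ℚ) ^ r * c := by exact_mod_cast hc
  have hp' : (p : ℚ) ≠ 0 := natCast_p_ne_zero
  rw [div_mul_eq_mul_div, hc', mul_div_cancel_left₀ _ (pow_ne_zero _ hp')]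

/-- The two fractional parts differ by an element of `ℤ[1/p]` that is a `p`-adic integer, hence by
an ordinary integer, and this integer lies in `(-1, 1)`. -/
theorem padicFract_eq {x y : ℚ_[p]} (h : ‖x - y‖ ≤ 1) : padicFract x = padicFract y := by
  obtain ⟨hx0, hx1, hx⟩ := padicFract_spec x
  obtain ⟨hy0, hy1, hy⟩ := padicFract_spec y
  have hn : ‖((padicFract x - padicFract y : ℚ) : ℚ_[p])‖ ≤ (p : ℝ) ^ 0 := by
    have e : ((padicFract x - padicFract y : ℚ) : ℚ_[p]) =
        ((x - y) + (y - (padicFract y : ℚ_[p]))) + -(x - (padicFract x : ℚ_[p])) := by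
      push_cast; ring
    rw [e, pow_zero]
    refine (Padic.nonarchimedean _ _).trans (max_le ((Padic.nonarchimedean _ _).trans
      (max_le h hy)) ?_)
    rwa [norm_neg]
  obtain ⟨c, hc⟩ := exists_int_of_norm_le
    ((Zinv p).sub_mem (padicFract_mem x) (padicFract_mem y)) 0 hn
  rw [pow_zero, mul_one] at hc
  have h1 : (c : ℚ) < 1 := by rw [← hc]; linarith
  have h2 : (-1 : ℚ) < c := by rw [← hc]; linarith
  have h3 : c < 1 := by exact_mod_cast h1
  have h4 : -1 < c := by exact_mod_cast h2
  obtain rfl : c = 0 := by omega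
  rw [Int.cast_zero] at hc
  linarith

theorem isLocallyConstant_padicFract : IsLocallyConstant (padicFract : ℚ_[p] → ℚ) := by
  rw [IsLocallyConstant.iff_eventually_eq]
  intro x
  filter_upwards [Metric.ball_mem_nhds x one_pos] with y hy
  rw [Metric.mem_ball, dist_eq_norm] at hy
  exact padicFract_eq hy.le

/-! ### Measurability of the approximation maps -/

instance : Countable (Zinv p) := inferInstanceAs (Countable (Zinv p : Set ℚ))

/-- The target is countable, so fibres suffice: a real fibre is the preimage of a set of integers
under a measurable floor, and a `p`-adic fibre is open because the fractional part is locally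
constant. -/
theorem measurable_trunc (M : ℤ) (s : Bool) : Measurable[_, ⊤] (trunc (p := p) M s) := by
  refine @measurable_to_countable' _ _ ⊤ _ _ _ fun q => ?_
  cases s with
  | true =>
    have h : @Measurable ℝ ℤ (borel ℝ) _ fun b : ℝ => ⌊(p : ℝ) ^ (-M) * b⌋ := by
      rw [← BorelSpace.measurable_eq (α := ℝ)]
      exact Int.measurable_floor.comp (measurable_const_mul _)
    have h2 : (trunc (p := p) M true) ⁻¹' {q} = (fun b : ℝ => ⌊(p : ℝ) ^ (-M) * b⌋) ⁻¹'
        {k : ℤ | (p : ℚ) ^ M * k = q} := by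
      ext b
      exact Subtype.ext_iff
    rw [h2]
    exact h (MeasurableSet.of_discrete)
  | false =>
    have h2 : (trunc (p := p) M false) ⁻¹' {q} = (fun b : ℚ_[p] => (p : ℚ_[p]) ^ (-M) * b) ⁻¹'
        (padicFract ⁻¹' {k : ℚ | (p : ℚ) ^ M * k = q}) := by
      ext b
      exact Subtype.ext_iff
    rw [h2]
    have : @IsOpen ℚ_[p] _ ((fun b : ℚ_[p] => (p : ℚ_[p]) ^ (-M) * b) ⁻¹'
        (padicFract ⁻¹' {k : ℚ | (p : ℚ) ^ M * k = q})) :=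
      (isLocallyConstant_padicFract _).preimage (continuous_const_mul _)
    exact MeasurableSpace.measurableSet_generateFrom this

theorem measurable_approx (μ : Measure (G n p)) (m : ℕ) : Measurable (approx μ m) := by
  let _ : MeasurableSpace (Zinv p) := ⊤
  have h1 : Measurable fun (b : Boundary μ) (q : {q : Fin n × Fin n // q.1 < q.2}) =>
      trunc (tvec μ m q.1.1 - tvec μ m q.1.2) (isNeg μ q.1.1 q.1.2) (b q) :=
    measurable_pi_lambda _ fun q => (measurable_trunc _ _).comp (measurable_pi_apply q)
  have h2 : Measurable fun (c : {q : Fin n × Fin n // q.1 < q.2} → Zinv p) =>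
      (⟨mkUT fun i j => if h : i < j then c ⟨(i, j), h⟩ else 0,
        Multiplicative.ofAdd (tvec μ m)⟩ : G n p) := measurable_of_countable _
  exact h2.comp h1

/-! ### The approximation maps have linear word length -/

theorem one_lt_natCast_p (p : ℕ) [Fact p.Prime] : (1 : ℝ) < p := by
  exact_mod_cast (Fact.out : p.Prime).one_lt

theorem zpow_le_pow_natAbs (M : ℤ) : (p : ℝ) ^ M ≤ (p : ℝ) ^ M.natAbs := by
  rw [← zpow_natCast]
  exact zpow_le_zpow_right₀ (one_lt_natCast_p p).le (by omega)

/-- `L` measures the size of `b` alone, so the length is linear in `M` once `b` is fixed. In `p +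
6`, the digits use `p + 2` and the conjugation at most `4`. -/
theorem exists_hasWord_trunc (s : Bool) (b : BEntry p s) :
    ∃ L : ℕ, ∀ (M : ℤ) (i j : Fin n), i < j →
      HasWord (elem i j (trunc M s b)) ((p + 6) * (M.natAbs + L)) := by
  have hp1 := one_lt_natCast_p p
  cases s with
  | true =>
    change ℝ at b
    obtain ⟨L, hL⟩ := pow_unbounded_of_one_lt (|b| + 1) hp1
    refine ⟨L, fun M i j hij => ?_⟩
    have hc : (⌊(p : ℝ) ^ (-M) * b⌋).natAbs < p ^ (M.natAbs + L) := by
      have h1 : |((⌊(p : ℝ) ^ (-M) * b⌋ : ℤ) : ℝ)| ≤ |(p : ℝ) ^ (-M) * b| + 1 := by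
        rw [abs_le]
        constructor
        · linarith [Int.lt_floor_add_one ((p : ℝ) ^ (-M) * b), neg_abs_le ((p : ℝ) ^ (-M) * b)]
        · linarith [Int.floor_le ((p : ℝ) ^ (-M) * b), le_abs_self ((p : ℝ) ^ (-M) * b)]
      have h2 : (p : ℝ) ^ (-M) ≤ (p : ℝ) ^ M.natAbs := by
        simpa using zpow_le_pow_natAbs (p := p) (-M)
      have h3 : (1 : ℝ) ≤ (p : ℝ) ^ M.natAbs := one_le_pow₀ hp1.le
      rw [abs_mul, abs_of_pos (zpow_pos (one_pos.trans hp1) _)] at h1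
      have h4 : (((⌊(p : ℝ) ^ (-M) * b⌋).natAbs : ℕ) : ℝ) < (p : ℝ) ^ (M.natAbs + L) := by
        rw [Nat.cast_natAbs, Int.cast_abs, pow_add]
        calc _ ≤ (p : ℝ) ^ (-M) * |b| + 1 := h1
          _ ≤ (p : ℝ) ^ M.natAbs * |b| + (p : ℝ) ^ M.natAbs := by gcongr
          _ = (p : ℝ) ^ M.natAbs * (|b| + 1) := by ring
          _ < _ := by gcongr
      exact_mod_cast h4
    have h := hasWord_elem_zpow_mul hij (hasWord_elem_intCast hij _ _ hc) M
    have e : trunc (p := p) M true b =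
        ((pUnit p ^ M : (Zinv p)ˣ) : Zinv p) * ((⌊(p : ℝ) ^ (-M) * b⌋ : ℤ) : Zinv p) := by
      refine Subtype.ext ?_
      rw [Subring.coe_mul, coe_pUnit_zpow]
      rfl
    rw [e]
    refine h.mono ?_
    have : (p + 6) * (M.natAbs + L) = (p + 2) * (M.natAbs + L) + 4 * (M.natAbs + L) := by ring
    omega
  | false =>
    change ℚ_[p] at b
    obtain ⟨L, hL⟩ := pow_unbounded_of_one_lt ‖b‖ hp1
    refine ⟨L, fun M i j hij => ?_⟩
    set z : ℚ_[p] := (p : ℚ_[p]) ^ (-M) * b with hz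
    obtain ⟨h0, h1, h2⟩ := padicFract_spec z
    have hzn : ‖z‖ ≤ (p : ℝ) ^ (M.natAbs + L) := by
      rw [hz, norm_mul, norm_zpow, Padic.norm_p, inv_zpow, zpow_neg, inv_inv, pow_add]
      gcongr
      exact zpow_le_pow_natAbs M
    have hfn : ‖(padicFract z : ℚ_[p])‖ ≤ (p : ℝ) ^ (M.natAbs + L) := by
      have e : (padicFract z : ℚ_[p]) = z + -(z - (padicFract z : ℚ_[p])) := by ring
      rw [e]
      refine (Padic.nonarchimedean _ _).trans (max_le hzn ?_)
      rw [norm_neg]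
      exact h2.trans (one_le_pow₀ hp1.le)
    obtain ⟨c, hc⟩ := exists_int_of_norm_le (padicFract_mem z) _ hfn
    have hpq : (0 : ℚ) < (p : ℚ) ^ (M.natAbs + L) := by
      have := (Fact.out : p.Prime).pos
      positivity
    have hc0 : 0 ≤ c := by
      have : (0 : ℚ) ≤ c := by rw [← hc]; positivity
      exact_mod_cast this
    have hc1 : c < (p : ℤ) ^ (M.natAbs + L) := by
      have : (c : ℚ) < (p : ℚ) ^ (M.natAbs + L) := by
        rw [← hc]; exact mul_lt_of_lt_one_left hpq h1
      exact_mod_cast this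
    have hc2 : c.natAbs < p ^ (M.natAbs + L) := by
      zify
      rwa [abs_of_nonneg hc0]
    -- The fractional part is `c / p ^ (|M| + L)`, so the conjugation supplies `p ^ M` and the
    -- denominator together.
    have h := hasWord_elem_zpow_mul hij (hasWord_elem_intCast hij _ _ hc2)
      (M - ((M.natAbs + L : ℕ) : ℤ))
    have e : trunc (p := p) M false b =
        ((pUnit p ^ (M - ((M.natAbs + L : ℕ) : ℤ)) : (Zinv p)ˣ) : Zinv p) * (c : Zinv p) := by
      refine Subtype.ext ?_
      rw [Subring.coe_mul, coe_pUnit_zpow]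
      change (p : ℚ) ^ M * padicFract z = _ * (c : ℚ)
      rw [← hc, zpow_sub₀ natCast_p_ne_zero, zpow_natCast]
      field_simp
    rw [e]
    refine h.mono ?_
    have : (M - ((M.natAbs + L : ℕ) : ℤ)).natAbs ≤ 2 * (M.natAbs + L) := by omega
    nlinarith

theorem exists_hasWord_approx (μ : Measure (G n p)) (b : Boundary μ) :
    ∃ C : ℕ, ∀ m : ℕ, 1 ≤ m → HasWord (approx μ m b) (C * m) := by
  -- The `+ 1` absorbs the rounding error of the floor once `1 ≤ m`.
  obtain ⟨A, hA⟩ : ∃ A : ℕ, ∀ i, |drift μ i| + 1 ≤ A := by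
    refine ⟨∑ i, ⌈|drift μ i| + 1⌉₊, fun i => (Nat.le_ceil _).trans ?_⟩
    exact_mod_cast Finset.single_le_sum (f := fun i => ⌈|drift μ i| + 1⌉₊)
      (fun _ _ => Nat.zero_le _) (Finset.mem_univ i)
  have ht : ∀ m : ℕ, 1 ≤ m → ∀ i, (tvec μ m i).natAbs ≤ A * m := by
    intro m hm i
    have hm' : (1 : ℝ) ≤ m := by exact_mod_cast hm
    have h1 : |((tvec μ m i : ℤ) : ℝ)| ≤ |(m : ℝ) * drift μ i| + 1 := by
      rw [abs_le, tvec]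
      constructor
      · linarith [Int.lt_floor_add_one ((m : ℝ) * drift μ i), neg_abs_le ((m : ℝ) * drift μ i)]
      · linarith [Int.floor_le ((m : ℝ) * drift μ i), le_abs_self ((m : ℝ) * drift μ i)]
    have h2 : (((tvec μ m i).natAbs : ℕ) : ℝ) ≤ A * m := by
      rw [Nat.cast_natAbs, Int.cast_abs]
      rw [abs_mul, abs_of_nonneg (zero_le_one.trans hm')] at h1
      nlinarith [hA i]
    exact_mod_cast h2
  choose L hL using fun q : {q : Fin n × Fin n // q.1 < q.2} =>
    exists_hasWord_trunc (n := n) (isNeg μ q.1.1 q.1.2) (b q)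
  refine ⟨n * n * ((p + 6) * (2 * A + ∑ q, L q)) + n * A, fun m hm => ?_⟩
  have hT : HasWord (⟨Tmat μ m b, 1⟩ : G n p)
      (n * n * ((p + 6) * (2 * (A * m) + ∑ q, L q))) := by
    refine hasWord_mkUT fun r s hrs => ?_
    rw [dif_pos hrs]
    refine (hL ⟨(r, s), hrs⟩ _ r s hrs).mono (Nat.mul_le_mul_left _ ?_)
    refine Nat.add_le_add ?_ (Finset.single_le_sum (fun _ _ => Nat.zero_le _) (Finset.mem_univ _))
    have := ht m hm r
    have := ht m hm s
    omega
  have h := hT.mul (hasWord_diagElt (p := p) (tvec μ m) (ht m hm))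
  rw [← eq_elem_mul_diagElt] at h
  refine h.mono ?_
  calc _ ≤ n * n * ((p + 6) * (2 * (A * m) + (∑ q, L q) * m)) + n * (A * m) := by
        gcongr
        exact Nat.le_mul_of_pos_right _ hm
    _ = _ := by ring

/-! ### Convergence of the matrix entries along a trajectory -/

theorem isBigO_exp_of_tendsto_div {v : ℕ → ℝ} {r r' : ℝ}
    (hv : Tendsto (fun m => v m / m) atTop (𝓝 r)) (hr : r < r') :
    (fun m => Real.exp (v m)) =O[atTop] fun m : ℕ => Real.exp (r' * m) := by
  refine Asymptotics.IsBigO.of_bound 1 ?_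
  filter_upwards [hv.eventually_lt_const hr, eventually_gt_atTop 0] with m hm hm0
  have hm0' : (0 : ℝ) < m := by exact_mod_cast hm0
  rw [Real.norm_eq_abs, Real.norm_eq_abs, Real.abs_exp, Real.abs_exp, one_mul, Real.exp_le_exp]
  exact ((div_lt_iff₀ hm0').1 hm).le

theorem isBigO_exp_of_increments {A u : ℕ → ℝ} {r : ℝ} (hr : 0 < r) (hA : ∀ m, 0 ≤ A m)
    (hAu : ∀ m, A (m + 1) ≤ A m + u m)
    (hu : u =O[atTop] fun m : ℕ => Real.exp (r * m)) :
    A =O[atTop] fun m : ℕ => Real.exp (r * m) := by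
  obtain ⟨C, hC, h⟩ := Asymptotics.bound_of_isBigO_nat_atTop hu
  have hu' : ∀ m, u m ≤ C * Real.exp (r * m) := fun m => by
    have := h (x := m) (Real.exp_ne_zero _)
    rw [Real.norm_eq_abs, Real.norm_eq_abs, Real.abs_exp] at this
    exact (le_abs_self _).trans this
  have he : 0 < Real.exp r - 1 := by linarith [Real.add_one_lt_exp hr.ne']
  -- Geometric sum: the first term starts the induction, the second makes `C ≤ K * (exp r - 1)`,
  -- which is what the inductive step consumes. Positivity of `r` enters here.
  set K := max (A 0) (C / (Real.exp r - 1)) with hK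
  have hCK : C ≤ K * (Real.exp r - 1) := by
    rw [← div_le_iff₀ he]; exact le_max_right _ _
  refine Asymptotics.IsBigO.of_bound K (Eventually.of_forall fun m => ?_)
  rw [Real.norm_eq_abs, Real.norm_eq_abs, Real.abs_exp, abs_of_nonneg (hA m)]
  induction m with
  | zero => simp [hK]
  | succ m ih =>
    have e : Real.exp (r * (m + 1 : ℕ)) = Real.exp (r * m) * Real.exp r := by
      rw [← Real.exp_add]; push_cast; ring_nf
    rw [e]
    calc A (m + 1) ≤ K * Real.exp (r * m) + C * Real.exp (r * m) :=
          (hAu m).trans (add_le_add ih (hu' m))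
      _ ≤ K * Real.exp (r * m) + K * (Real.exp r - 1) * Real.exp (r * m) := by gcongr
      _ = _ := by ring

theorem entry_mul_eq_add (g h : G n p) (i k : Fin n) :
    entry (g * h) i k = entry g i k +
      ∑ l ∈ Finset.Iio k, entry g i l * (p : ℚ) ^ (disp g l - disp g k) * entry h l k := by
  rw [entry_mul, ← Finset.sum_subset (Finset.subset_univ (Finset.Iic k)), ← Finset.Iio_insert,
    Finset.sum_insert (by simp), entry_diag, sub_self, zpow_zero, mul_one, mul_one]
  intro l _ hl
  rw [Finset.mem_Iic, not_le] at hl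
  rw [entry_of_lt h hl, mul_zero]

theorem cauchySeq_entry {K : Type*} [NormedField K] [CharZero K] {w g : ℕ → G n p} {N : ℕ → ℕ}
    {d : Fin n → ℝ} (hw : ∀ m, w (m + 1) = w m * g m)
    (hd : ∀ i, Tendsto (fun m : ℕ => (disp (w m) i : ℝ) / m) atTop (𝓝 (d i)))
    (hg : ∀ m, HasWord (g m) (N m)) (hN : Tendsto (fun m : ℕ => (N m : ℝ) / m) atTop (𝓝 0))
    (i j : Fin n) (hj : ∀ k < j, Real.log ‖(p : K)‖ * (d k - d j) < 0) :
    CauchySeq fun m => ((entry (w m) i j : ℚ) : K) := by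
  have hp : (p : K) ≠ 0 := by exact_mod_cast (Fact.out : p.Prime).ne_zero
  have hpos : 0 < ‖(p : K)‖ := norm_pos_iff.2 hp
  set L := Real.log ‖(p : K)‖ with hL
  -- the growth of the scalars `p ^ (y_l - y_k)` and of the increments
  have hzpow : ∀ l k : Fin n, ∀ r, L * (d l - d k) < r →
      (fun m => ‖(p : K) ^ (disp (w m) l - disp (w m) k)‖) =O[atTop]
        fun m : ℕ => Real.exp (r * m) := by
    intro l k r hr
    have e : (fun m => ‖(p : K) ^ (disp (w m) l - disp (w m) k)‖) =
        fun m => Real.exp (L * (disp (w m) l - disp (w m) k)) := by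
      funext m
      rw [norm_zpow, ← Real.rpow_intCast, Real.rpow_def_of_pos hpos]
      push_cast; rfl
    rw [e]
    refine isBigO_exp_of_tendsto_div ?_ hr
    refine (((hd l).sub (hd k)).const_mul L).congr fun m => ?_
    ring
  obtain ⟨B, hB1, hB⟩ := exists_norm_entry_le n p K
  have hent : ∀ l k : Fin n, ∀ r, 0 < r → (fun m => ‖((entry (g m) l k : ℚ) : K)‖) =O[atTop]
      fun m : ℕ => Real.exp (r * m) := by
    intro l k r hr
    have h1 : (fun m => ‖((entry (g m) l k : ℚ) : K)‖) =O[atTop]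
        fun m => Real.exp (Real.log B * N m) := by
      refine Asymptotics.IsBigO.of_bound 1 (Eventually.of_forall fun m => ?_)
      rw [norm_norm, Real.norm_eq_abs, Real.abs_exp, one_mul, mul_comm, Real.exp_nat_mul,
        Real.exp_log (by linarith)]
      exact hB _ _ (hg m) _ _
    refine h1.trans (isBigO_exp_of_tendsto_div (r := Real.log B * 0) ?_ (by simpa))
    refine (hN.const_mul (Real.log B)).congr fun m => ?_
    ring
  -- a common bound for the exponents in the columns to the left of `j`
  obtain ⟨c, hcj, hc⟩ : ∃ c, c < L * d j ∧ ∀ k < j, L * d k ≤ c := by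
    -- Approaching `L * d j` from the left meets the finitely many conditions at once, and also
    -- covers the case of no `k < j`.
    have h : ∀ᶠ c in 𝓝[<] (L * d j), ∀ k : Fin n, k < j → L * d k ≤ c := by
      rw [eventually_all]
      intro k
      by_cases hk : k < j
      · have := hj k hk
        filter_upwards [Ioo_mem_nhdsLT (show L * d k < L * d j by linarith)] with c hc _
        exact hc.1.le
      · exact Eventually.of_forall fun c h => absurd h hk
    obtain ⟨c, h1, h2⟩ := (h.and self_mem_nhdsWithin).exists
    exact ⟨c, h2, h1⟩
  set a : Fin n → ℕ → K := fun k m => ((entry (w m) i k : ℚ) : K) with ha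
  set u : Fin n → ℕ → K := fun k m => ∑ l ∈ Finset.Iio k,
    a l m * (p : K) ^ (disp (w m) l - disp (w m) k) * ((entry (g m) l k : ℚ) : K) with hu
  have hstep : ∀ k m, a k (m + 1) = a k m + u k m := by
    intro k m
    simp only [ha, hu, hw, entry_mul_eq_add]
    push_cast
    rfl
  -- The exponents telescope: `(c - L d l) + L (d l - d k) = c - L d k`, so every `l` contributes
  -- the same rate.
  have hinc : ∀ k, (∀ l < k, ∀ r, c - L * d l < r → (fun m => ‖a l m‖) =O[atTop]
      fun m : ℕ => Real.exp (r * m)) → ∀ r, c - L * d k < r → (fun m => ‖u k m‖) =O[atTop]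
      fun m : ℕ => Real.exp (r * m) := by
    intro k hk r hr
    have e : u k = fun m => ∑ l ∈ Finset.Iio k,
        a l m * (p : K) ^ (disp (w m) l - disp (w m) k) * ((entry (g m) l k : ℚ) : K) := rfl
    rw [e]
    refine Asymptotics.IsBigO.norm_left (Asymptotics.IsBigO.fun_sum fun l hl => ?_)
    -- Each of the three factors loses `η`, and `3 η` is less than the available gap `4 η`.
    set η := (r - (c - L * d k)) / 4 with hη
    have hη0 : 0 < η := by rw [hη]; linarith
    have h := ((hk l (Finset.mem_Iio.1 hl) (c - L * d l + η) (by linarith)).mul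
      (hzpow l k (L * (d l - d k) + η) (by linarith))).mul (hent l k η hη0)
    refine Asymptotics.IsBigO.of_norm_left ?_
    simp only [norm_mul]
    refine h.trans (Asymptotics.IsBigO.of_bound 1 (Eventually.of_forall fun m => ?_))
    simp only [← Real.exp_add, Real.norm_eq_abs, Real.abs_exp, one_mul, Real.exp_le_exp]
    rw [← add_mul, ← add_mul]
    refine mul_le_mul_of_nonneg_right ?_ (Nat.cast_nonneg m)
    linarith
  have hgrow : ∀ k, k < j → ∀ r, c - L * d k < r → (fun m => ‖a k m‖) =O[atTop]
      fun m : ℕ => Real.exp (r * m) := by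
    intro k
    induction k using WellFoundedLT.induction with
    | ind k ih =>
      intro hk r hr
      refine isBigO_exp_of_increments ?_ (fun m => norm_nonneg _) (fun m => ?_)
        (hinc k (fun l hl => ih l hl (hl.trans hk)) r hr)
      -- The rate is positive because `L * d k ≤ c`; this is why the sums grow no faster than the
      -- increments.
      · linarith [hc k hk]
      · rw [hstep]; exact norm_add_le _ _
  -- Half of the negative number `c - L * d j` lies strictly between it and `0`, so the increments
  -- decay exponentially.
  have hsum := hinc j hgrow ((c - L * d j) / 2) (by linarith)
  have hexp : Summable fun m : ℕ => Real.exp ((c - L * d j) / 2 * m) := by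
    simp only [mul_comm _ ((_ : ℕ) : ℝ)]
    exact Real.summable_exp_nat_mul_iff.2 (by linarith)
  refine cauchySeq_of_summable_dist (f := a j) ?_
  refine (summable_of_isBigO_nat hexp hsum).congr fun m => ?_
  rw [dist_comm, dist_eq_norm, hstep, add_sub_cancel_left]

theorem exists_convergesTo {μ : Measure (G n p)} (hD : DispNonzero μ) (hcol : ColumnConsistent μ)
    {w g : ℕ → G n p} {N : ℕ → ℕ} (hw : ∀ m, w (m + 1) = w m * g m)
    (hd : ∀ i, Tendsto (fun m : ℕ => (disp (w m) i : ℝ) / m) atTop (𝓝 (drift μ i)))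
    (hg : ∀ m, HasWord (g m) (N m)) (hN : Tendsto (fun m : ℕ => (N m : ℝ) / m) atTop (𝓝 0)) :
    ∃ b : Boundary μ, ConvergesTo μ w b := by
  have h : ∀ q : {q : Fin n × Fin n // q.1 < q.2}, ∃ b : BEntry p (isNeg μ q.1.1 q.1.2),
      Tendsto (fun m => (ofRat _ (entry (w m) q.1.1 q.1.2) : BEntry p (isNeg μ q.1.1 q.1.2)))
        atTop (𝓝 b) := by
    rintro ⟨⟨i, j⟩, hij⟩
    change i < j at hij
    change ∃ b : BEntry p (isNeg μ i j),
      Tendsto (fun m => (ofRat _ (entry (w m) i j) : BEntry p (isNeg μ i j))) atTop (𝓝 b)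
    have hp1 := one_lt_natCast_p p
    have hlog : 0 < Real.log p := Real.log_pos hp1
    rcases lt_or_gt_of_ne (hD i j hij) with hneg | hpos
    · have e : isNeg μ i j = true := by simp [isNeg, hneg]
      rw [e]
      refine cauchySeq_tendsto_of_complete (cauchySeq_entry (K := ℝ) hw hd hg hN i j
        fun k hk => ?_)
      -- Column consistency transfers the sign at `(i, j)` to every `(k, j)` with `k < j`.
      have hs := hcol i k j hij hk
      rw [sign_neg hneg, eq_comm, sign_eq_neg_one_iff] at hs
      rw [Real.norm_natCast]
      exact mul_neg_of_pos_of_neg hlog hs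
    · have e : isNeg μ i j = false := by simp [isNeg, hpos.le]
      rw [e]
      refine cauchySeq_tendsto_of_complete (cauchySeq_entry (K := ℚ_[p]) hw hd hg hN i j
        fun k hk => ?_)
      have hs := hcol i k j hij hk
      rw [sign_pos hpos, eq_comm, sign_eq_one_iff] at hs
      rw [Padic.norm_p, Real.log_inv]
      exact mul_neg_of_neg_of_pos (neg_lt_zero.2 hlog) hs
  choose b hb using h
  exact ⟨b, hb⟩

/-! ### The law of large numbers along the walk -/

/-- The word length as a natural number. -/
def len (g : G n p) : ℕ := (wordLength g).toNat

theorem hasWord_len {g : G n p} (h : wordLength g ≠ ⊤) : HasWord g (len g) :=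
  hasWord_iff.1 (ENat.natCast_toNat h).ge

/-- The moment condition alone makes almost every increment a word in the generators, so generation
of the whole group need not be proved, and the default value of `len` at `⊤` is harmless. -/
theorem ae_wordLength_ne_top {μ : Measure (G n p)} (h : FiniteFirstMoment μ) :
    ∀ᵐ g ∂μ, wordLength g ≠ ⊤ := by
  filter_upwards [ae_lt_top (fun _ _ => trivial) h.ne] with g hg hg'
  rw [hg', ENat.toENNReal_top] at hg
  exact lt_irrefl _ hg

theorem integrable_len {μ : Measure (G n p)} (h : FiniteFirstMoment μ) :
    Integrable (fun g => (len g : ℝ)) μ := by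
  refine ⟨Measurable.aestronglyMeasurable fun _ _ => trivial, ?_⟩
  refine lt_of_le_of_lt (lintegral_mono fun g => ?_) h
  rw [Real.enorm_eq_ofReal (Nat.cast_nonneg _), ENNReal.ofReal_natCast, len, ← ENat.toENNReal_coe,
    ENat.toENNReal_le]
  exact ENat.natCast_toNat_le_self _

theorem integrable_disp {μ : Measure (G n p)} (h : FiniteFirstMoment μ) (i : Fin n) :
    Integrable (fun g => (disp g i : ℝ)) μ := by
  refine (integrable_len h).mono' (Measurable.aestronglyMeasurable fun _ _ => trivial) ?_
  filter_upwards [ae_wordLength_ne_top h] with g hg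
  rw [Real.norm_eq_abs]
  exact_mod_cast (hasWord_len hg).abs_disp_le i

theorem ae_tendsto_average {μ : Measure (G n p)} {Ω : Type*} [MeasurableSpace Ω]
    {P : Measure Ω} {X : ℕ → Ω → G n p} (hX : ∀ k, Measurable (X k)) (hindep : iIndepFun X P)
    (hlaw : ∀ k, P.map (X k) = μ) {f : G n p → ℝ} (hf : Integrable f μ) :
    ∀ᵐ ω ∂P, Tendsto (fun m : ℕ => (∑ k ∈ Finset.range m, f (X k ω)) / m) atTop
      (𝓝 (∫ g, f g ∂μ)) := by
  have hfm : Measurable f := fun _ _ => trivial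
  have h := strong_law_ae_real (μ := P) (fun k ω => f (X k ω))
    ((hlaw 0 ▸ hf).comp_measurable (hX 0))
    (fun i j hij => (hindep.indepFun hij).comp hfm hfm)
    (fun i => (IdentDistrib.mk (hX i).aemeasurable (hX 0).aemeasurable
      ((hlaw i).trans (hlaw 0).symm)).comp hfm)
  have e : ∫ ω, f (X 0 ω) ∂P = ∫ g, f g ∂μ := by
    rw [← hlaw 0, integral_map (hX 0).aemeasurable hfm.aestronglyMeasurable]
  rw [e] at h
  exact h

/-- `v m / m` is the difference of two consecutive partial sums divided by `m`, and both quotients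
tend to `c`. -/
theorem tendsto_div_zero_of_average {v : ℕ → ℝ} {c : ℝ}
    (h : Tendsto (fun m : ℕ => (∑ k ∈ Finset.range m, v k) / m) atTop (𝓝 c)) :
    Tendsto (fun m : ℕ => v m / m) atTop (𝓝 0) := by
  have h1 : Tendsto (fun m : ℕ => (∑ k ∈ Finset.range (m + 1), v k) / ((m + 1 : ℕ) : ℝ) *
      (((m + 1 : ℕ) : ℝ) / m)) atTop (𝓝 (c * 1)) := by
    refine (h.comp (tendsto_add_atTop_nat 1)).mul ?_
    have h2 : Tendsto (fun m : ℕ => 1 + 1 / (m : ℝ)) atTop (𝓝 (1 + 0)) :=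
      tendsto_const_nhds.add tendsto_one_div_atTop_nhds_zero_nat
    rw [add_zero] at h2
    refine h2.congr' ?_
    filter_upwards [eventually_gt_atTop 0] with m hm
    have : (m : ℝ) ≠ 0 := by exact_mod_cast hm.ne'
    push_cast
    field_simp
  have h3 := h1.sub h
  rw [mul_one, sub_self] at h3
  refine h3.congr fun m => ?_
  have : ((m + 1 : ℕ) : ℝ) ≠ 0 := by exact_mod_cast m.succ_ne_zero
  rw [div_mul_div_cancel₀ this, Finset.sum_range_succ]
  ring

theorem disp_walk {Ω : Type*} (X : ℕ → Ω → G n p) (m : ℕ) (ω : Ω) (i : Fin n) :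
    disp (walk X m ω) i = ∑ k ∈ Finset.range m, disp (X k ω) i := by
  induction m with
  | zero => rfl
  | succ m ih => rw [Finset.sum_range_succ, ← ih]; rfl

theorem hasWord_walk {Ω : Type*} {X : ℕ → Ω → G n p} {ω : Ω} {N : ℕ → ℕ}
    (h : ∀ k, HasWord (X k ω) (N k)) (m : ℕ) :
    HasWord (walk X m ω) (∑ k ∈ Finset.range m, N k) := by
  induction m with
  | zero => exact hasWord_one
  | succ m ih => rw [Finset.sum_range_succ]; exact ih.mul (h m)

end SolvWalk

end

theorem mainTheorem9 {n p : ℕ} [Fact p.Prime]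
    (μ : MeasureTheory.Measure (SolvWalk.G n p)) [MeasureTheory.IsProbabilityMeasure μ]
    (hmoment : SolvWalk.FiniteFirstMoment μ)
    (hnonab : SolvWalk.SupportNonabelian μ)
    (hD : SolvWalk.DispNonzero μ)
    (hcol : SolvWalk.ColumnConsistent μ)
    {Ω : Type*} [MeasurableSpace Ω] (P : MeasureTheory.Measure Ω)
    [MeasureTheory.IsProbabilityMeasure P]
    (X : ℕ → Ω → SolvWalk.G n p)
    (hX : ∀ k, Measurable (X k))
    (hindep : ProbabilityTheory.iIndepFun X P)
    (hlaw : ∀ k, P.map (X k) = μ) :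
    (∀ m : ℕ, Measurable (SolvWalk.approx μ m)) ∧
    ∀ᵐ ω ∂P, ∃ b : SolvWalk.Boundary μ,
      SolvWalk.ConvergesTo μ (fun m => SolvWalk.walk X m ω) b ∧
      ∃ C : ℕ, ∀ᶠ m : ℕ in Filter.atTop,
        SolvWalk.wordLength ((SolvWalk.approx μ m b)⁻¹ * SolvWalk.walk X m ω) ≤
          ((C * m : ℕ) : ℕ∞) := by
  refine ⟨SolvWalk.measurable_approx μ, ?_⟩
  have hfin : ∀ᵐ ω ∂P, ∀ k, SolvWalk.wordLength (X k ω) ≠ ⊤ := by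
    rw [ae_all_iff]
    intro k
    have h := SolvWalk.ae_wordLength_ne_top hmoment
    rw [← hlaw k] at h
    exact ae_of_ae_map (hX k).aemeasurable h
  have hlen := SolvWalk.ae_tendsto_average hX hindep hlaw (SolvWalk.integrable_len hmoment)
  have hdisp : ∀ᵐ ω ∂P, ∀ i, Tendsto
      (fun m : ℕ => (∑ k ∈ Finset.range m, (SolvWalk.disp (X k ω) i : ℝ)) / m) atTop
      (𝓝 (SolvWalk.drift μ i)) := by
    rw [ae_all_iff]
    exact fun i => SolvWalk.ae_tendsto_average hX hindep hlaw
      (SolvWalk.integrable_disp hmoment i)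
  filter_upwards [hfin, hlen, hdisp] with ω hfin hlen hdisp
  have hword : ∀ k, SolvWalk.HasWord (X k ω) (SolvWalk.len (X k ω)) :=
    fun k => SolvWalk.hasWord_len (hfin k)
  obtain ⟨b, hb⟩ := SolvWalk.exists_convergesTo hD hcol
    (w := fun m => SolvWalk.walk X m ω) (g := fun m => X m ω) (fun _ => rfl)
    (fun i => (hdisp i).congr fun m => by rw [SolvWalk.disp_walk, Int.cast_sum])
    hword (SolvWalk.tendsto_div_zero_of_average hlen)
  refine ⟨b, hb, ?_⟩
  obtain ⟨C, hC⟩ := SolvWalk.exists_hasWord_approx μ b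
  -- Strictly above the mean length, so the averages are eventually below `A`.
  obtain ⟨A, hA⟩ := exists_nat_gt (∫ g, (SolvWalk.len g : ℝ) ∂μ)
  refine ⟨C + A, ?_⟩
  filter_upwards [hlen.eventually_lt_const hA, eventually_ge_atTop 1] with m hm hm1
  rw [SolvWalk.hasWord_iff]
  refine ((hC m hm1).inv.mul (SolvWalk.hasWord_walk hword m)).mono ?_
  have hm0 : (0 : ℝ) < m := by exact_mod_cast hm1
  rw [div_lt_iff₀ hm0] at hm
  have : ∑ k ∈ Finset.range m, SolvWalk.len (X k ω) < A * m := by exact_mod_cast hm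
  rw [add_mul]
  omega
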